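/- Let $G$ be a compact Hausdorff topological group, let $\operatorname{Aut}(G)$ be the group of topological automorphisms of $G$ with the compact-open topology, and let $P\le\operatorname{Aut}(G)$ be an arbitrary (not necessarily closed) subgroup. Let $G\rtimes P$ be the natural semidirect product, with multiplication $(g,f)(g',f')=(g\,f(g'),ff')$ and with the product topology, where $P$ carries the subspace topology. For $g\in G$ let $\gamma_g\in\operatorname{Aut}(G)$ be the inner automorphism $\gamma_g(x)=gxg^{-1}$, put $\operatorname{Inn}(G)=\{\gamma_g : g\in G\}$, and let $\Gamma\colon G\to\operatorname{Inn}(G)$, $\Gamma(g)=\gamma_g$. A Hausdorff topological group is called minimal if it admits no strictly coarser Hausdorff group topology. Then the following two conditions are equivalent: 1. $G\rtimes P$ is not minimal. 2. There exists a closed nontrivial subgroup $H$ of $G$ such that (a) $H\cap Z(G)=\{e_G\}$, where $Z(G)$ is the center of $G$; (b) $H$ is $P$-invariant, that is, $f(H)\subseteq H$ for every $f\in P$; (c) $\Gamma(H)\subseteq\overline{P}$ and $\Gamma(H)\cap P=\{\mathrm{id}_G\}$, where $\overline{P}$ is the closure of $P$ in $\operatorname{Aut}(G)$. -/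

import Mathlib

/-! ## The automorphism group of a topological group -/

section TopAut

variable {G : Type*} [Group G] [TopologicalSpace G]

/-- The topological automorphisms of `G` form a group under composition,
`(f * g) x = f (g x)`. -/
instance ContinuousMulEquiv.instGroupAut : Group (G ≃ₜ* G) where
  mul f g := g.trans f
  one := ContinuousMulEquiv.refl G
  inv f := f.symm
  mul_assoc _ _ _ := rfl
  one_mul _ := rfl
  mul_one _ := rfl
  inv_mul_cancel f := ContinuousMulEquiv.ext f.symm_apply_apply

/-- The inclusion of the topological automorphisms of `G` into the continuous self-maps of `G`. -/
def ContinuousMulEquiv.autToContinuousMap (f : G ≃ₜ* G) : C(G, G) :=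
  ⟨f, f.continuous_toFun⟩

/-- The compact-open topology on `Aut(G)`. -/
instance ContinuousMulEquiv.instTopologicalSpaceAut : TopologicalSpace (G ≃ₜ* G) :=
  TopologicalSpace.induced ContinuousMulEquiv.autToContinuousMap inferInstance

/-- The group `Aut(G)` of topological automorphisms acts on the abstract group `G`. -/
def ContinuousMulEquiv.autToMulAut (G : Type*) [Group G] [TopologicalSpace G] :
    (G ≃ₜ* G) →* MulAut G where
  toFun f := f.toMulEquiv
  map_one' := rfl
  map_mul' _ _ := rfl

/-- `Γ(g)` is the inner automorphism `x ↦ g * x * g⁻¹`, as a topological automorphism. -/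
def ContinuousMulEquiv.innerAut (G : Type*) [Group G] [TopologicalSpace G]
    [IsTopologicalGroup G] : G →* (G ≃ₜ* G) where
  toFun g :=
    { MulAut.conj g with
      continuous_toFun := by
        change Continuous fun x : G => g * x * g⁻¹
        fun_prop
      continuous_invFun := by
        change Continuous fun x : G => g⁻¹ * x * g
        fun_prop }
  map_one' := ContinuousMulEquiv.ext fun x => by
    change 1 * x * 1⁻¹ = x
    simp
  map_mul' g h := ContinuousMulEquiv.ext fun x => by
    change (g * h) * x * (g * h)⁻¹ = g * (h * x * h⁻¹) * g⁻¹
    group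

end TopAut

/-! ## Topological semidirect products -/

/-- The product topology on a semidirect product. -/
instance SemidirectProduct.instTopologicalSpaceProd {N K : Type*} [Group N] [Group K]
    [TopologicalSpace N] [TopologicalSpace K] (φ : K →* MulAut N) :
    TopologicalSpace (N ⋊[φ] K) :=
  TopologicalSpace.induced (fun x => (x.left, x.right)) inferInstance

/-- The natural semidirect product of `G` with a group `P` of topological automorphisms of `G`:
`(g, f) * (g', f') = (g * f g', f * f')`. It carries the product of the topology of `G` and the
topology that `P` inherits from the compact-open topology of `Aut(G)`. -/
abbrev AutSemidirect {G : Type*} [Group G] [TopologicalSpace G] (P : Subgroup (G ≃ₜ* G)) :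
    Type _ :=
  G ⋊[(ContinuousMulEquiv.autToMulAut G).comp P.subtype] P

/-! ## Minimal topological groups -/

/-- A Hausdorff topological group is minimal if it has no strictly coarser Hausdorff group
topology. (In Mathlib's order on topologies, `t < s` says that `s` is strictly coarser
than `t`.) -/
def IsMinimalTopologicalGroup (M : Type*) [Group M] [t : TopologicalSpace M]
    [IsTopologicalGroup M] [T2Space M] : Prop :=
  ¬ ∃ s : TopologicalSpace M, t < s ∧ @IsTopologicalGroup M s _ ∧ @T2Space M s

/-! ## `G ⋊ P` is a Hausdorff topological group for compact Hausdorff `G` -/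

section Instances

variable {G : Type*} [Group G] [TopologicalSpace G]

lemma ContinuousMulEquiv.continuous_autToContinuousMap :
    Continuous (autToContinuousMap : (G ≃ₜ* G) → C(G, G)) :=
  continuous_induced_dom

instance ContinuousMulEquiv.instT2SpaceAut [T2Space G] : T2Space (G ≃ₜ* G) :=
  T2Space.of_injective_continuous (f := autToContinuousMap)
    (fun _ _ h => ContinuousMulEquiv.ext fun x => DFunLike.congr_fun h x)
    continuous_autToContinuousMap

instance ContinuousMulEquiv.instIsTopologicalGroupAut [CompactSpace G] [T2Space G] :
    IsTopologicalGroup (G ≃ₜ* G) where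
  continuous_mul := continuous_induced_rng.2 <|
    ContinuousMap.continuous_comp'.comp <|
      (continuous_autToContinuousMap.comp continuous_snd).prodMk
        (continuous_autToContinuousMap.comp continuous_fst)
  continuous_inv := by
    refine continuous_induced_rng.2 (ContinuousMap.continuous_compactOpen.2 fun K hK U hU => ?_)
    have h : {f : G ≃ₜ* G | Set.MapsTo (autToContinuousMap f⁻¹) K U} =
        autToContinuousMap ⁻¹' {f : C(G, G) | Set.MapsTo f Uᶜ Kᶜ} := by
      ext f
      constructor
      · intro hf x hx hxK
        refine hx ?_
        have := hf hxK
        rwa [show autToContinuousMap f⁻¹ (autToContinuousMap f x) = x from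
          f.symm_apply_apply x] at this
      · intro hf x hx
        by_contra hxU
        refine hf hxU ?_
        rwa [show autToContinuousMap f (autToContinuousMap f⁻¹ x) = x from
          f.apply_symm_apply x]
    change IsOpen {f : G ≃ₜ* G | Set.MapsTo (autToContinuousMap f⁻¹) K U}
    rw [h]
    exact (ContinuousMap.isOpen_setOfPred_mapsTo hU.isClosed_compl.isCompact
      hK.isClosed.isOpen_compl).preimage continuous_autToContinuousMap

lemma SemidirectProduct.continuous_toProd {N K : Type*} [Group N] [Group K]
    [TopologicalSpace N] [TopologicalSpace K] (φ : K →* MulAut N) :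
    Continuous fun x : N ⋊[φ] K => (x.left, x.right) :=
  continuous_induced_dom

instance AutSemidirect.instT2Space [T2Space G] (P : Subgroup (G ≃ₜ* G)) :
    T2Space (AutSemidirect P) :=
  T2Space.of_injective_continuous
    (fun _ _ h => SemidirectProduct.ext (congrArg Prod.fst h) (congrArg Prod.snd h))
    (SemidirectProduct.continuous_toProd _)

instance AutSemidirect.instIsTopologicalGroup [IsTopologicalGroup G] [CompactSpace G]
    [T2Space G] (P : Subgroup (G ≃ₜ* G)) : IsTopologicalGroup (AutSemidirect P) := by
  have hl : Continuous fun x : AutSemidirect P => x.left :=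
    continuous_fst.comp (SemidirectProduct.continuous_toProd _)
  have hr : Continuous fun x : AutSemidirect P => x.right :=
    continuous_snd.comp (SemidirectProduct.continuous_toProd _)
  have hact : Continuous fun q : P × G => (q.1 : G ≃ₜ* G) q.2 := by
    have h : Continuous fun q : P × G =>
        (ContinuousMulEquiv.autToContinuousMap (q.1 : G ≃ₜ* G)) q.2 :=
      ((ContinuousMulEquiv.continuous_autToContinuousMap.comp
        continuous_subtype_val).comp continuous_fst).eval continuous_snd
    exact h
  refine { continuous_mul := ?_, continuous_inv := ?_ }
  · refine continuous_induced_rng.2 (Continuous.prodMk ?_ ?_)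
    · exact (hl.comp continuous_fst).mul
        (hact.comp ((hr.comp continuous_fst).prodMk (hl.comp continuous_snd)))
    · exact (hr.comp continuous_fst).mul (hr.comp continuous_snd)
  · refine continuous_induced_rng.2 (Continuous.prodMk ?_ ?_)
    · exact hact.comp (hr.inv.prodMk hl.inv)
    · exact hr.inv

end Instances

/-! The proof rests on the homomorphism `conjAut`, `(g, f) ↦ γ_g f`. In any coarser Hausdorff group
topology the compact subgroup `G` keeps its topology, so `conjAut` stays continuous
(`continuous_conjAut_symm`). It restricts to the inclusion on `P`, so only the position of `P`
relative to `G` can change.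

Not minimal ⇒ `H`: let `H` be the trace on `G` of the coarse closure of `P`. Applying `conjAut`
gives `Γ(H) ⊆ cl(P)`, and uniqueness of limits excludes `γ_h ∈ P` for `h ≠ 1` in `H`. If `H` were
trivial, compactness of `G` would force the two topologies to agree (`comap_nhds_one_le`).

`H` ⇒ not minimal: the elements `(h, γ_h⁻¹)` form a closed normal subgroup `N` of `G ⋊ cl(P)`
meeting the dense subgroup `G ⋊ P` trivially. So `G ⋊ P` embeds algebraically in the quotient by
`N`, where points tending to a nontrivial element of `N` now tend to 1.

The coarser topology is carried by a separate group `X` with an isomorphism `φ`, which keeps the two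
topologies apart. -/

open Filter Topology

namespace AutSemidirect

open SemidirectProduct

section Algebra

variable {G : Type*} [Group G] [TopologicalSpace G] [IsTopologicalGroup G]

/-- The action of `G ⋊ P` on its normal subgroup `G` by conjugation, `(g, f) ↦ γ_g f`. -/
def conjAut (P : Subgroup (G ≃ₜ* G)) : AutSemidirect P →* (G ≃ₜ* G) :=
  SemidirectProduct.lift (ContinuousMulEquiv.innerAut G) P.subtype fun f =>
    MonoidHom.ext fun g => ContinuousMulEquiv.ext fun x => by
      change (f : G ≃ₜ* G) g * x * ((f : G ≃ₜ* G) g)⁻¹ =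
        (f : G ≃ₜ* G) (g * (f : G ≃ₜ* G).symm x * g⁻¹)
      simp

lemma conjAut_apply (P : Subgroup (G ≃ₜ* G)) (m : AutSemidirect P) (x : G) :
    conjAut P m x = m.left * (m.right : G ≃ₜ* G) x * m.left⁻¹ :=
  rfl

lemma conjAut_inl (P : Subgroup (G ≃ₜ* G)) (g : G) :
    conjAut P (inl g) = ContinuousMulEquiv.innerAut G g :=
  SemidirectProduct.lift_inl _ _ _ _

lemma conjAut_inr (P : Subgroup (G ≃ₜ* G)) (f : P) : conjAut P (inr f) = f :=
  SemidirectProduct.lift_inr _ _ _ _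

lemma inl_conjAut (P : Subgroup (G ≃ₜ* G)) (m : AutSemidirect P) (x : G) :
    (inl (conjAut P m x) : AutSemidirect P) = m * inl x * m⁻¹ := by
  have h : (inl ((m.right : G ≃ₜ* G) x) : AutSemidirect P) =
      inr m.right * inl x * inr m.right⁻¹ := SemidirectProduct.inl_aut _ _
  conv_rhs => rw [← SemidirectProduct.inl_left_mul_inr_right m]
  rw [conjAut_apply, map_mul, map_mul, h]
  simp only [map_inv, mul_inv_rev, mul_assoc]

end Algebra

section Continuity

variable {G : Type*} [Group G] [TopologicalSpace G]

lemma continuous_mk (P : Subgroup (G ≃ₜ* G)) :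
    Continuous fun q : G × P => (⟨q.1, q.2⟩ : AutSemidirect P) :=
  continuous_induced_rng.2 continuous_id

lemma continuous_inl (P : Subgroup (G ≃ₜ* G)) : Continuous (inl : G → AutSemidirect P) :=
  (continuous_mk P).comp (continuous_id.prodMk continuous_const)

lemma continuous_inr (P : Subgroup (G ≃ₜ* G)) : Continuous (inr : P → AutSemidirect P) :=
  (continuous_mk P).comp (continuous_const.prodMk continuous_id)

lemma continuous_left (P : Subgroup (G ≃ₜ* G)) :
    Continuous fun m : AutSemidirect P => m.left :=
  continuous_fst.comp (SemidirectProduct.continuous_toProd _)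

/-- The inclusion `G ⋊ P → G ⋊ Q` for `P ≤ Q`. -/
def inclusion {P Q : Subgroup (G ≃ₜ* G)} (h : P ≤ Q) : AutSemidirect P →* AutSemidirect Q :=
  SemidirectProduct.map (MonoidHom.id G) (Subgroup.inclusion h) fun _ => rfl

lemma continuous_inclusion {P Q : Subgroup (G ≃ₜ* G)} (h : P ≤ Q) : Continuous (inclusion h) :=
  (continuous_mk Q).comp <| (continuous_id.prodMap (_root_.continuous_inclusion h)).comp <|
    SemidirectProduct.continuous_toProd _

lemma denseRange_inclusion {P Q : Subgroup (G ≃ₜ* G)} (h : P ≤ Q)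
    (hQ : (Q : Set (G ≃ₜ* G)) ⊆ closure (P : Set (G ≃ₜ* G))) : DenseRange (inclusion h) := by
  have h1 : DenseRange (Prod.map id (Set.inclusion h) : G × P → G × Q) :=
    denseRange_id.prodMap ((denseRange_inclusion_iff h).2 hQ)
  have h2 : Function.Surjective fun q : G × Q => (⟨q.1, q.2⟩ : AutSemidirect Q) :=
    fun m => ⟨(m.left, m.right), rfl⟩
  refine (h2.denseRange.comp h1 (continuous_mk Q)).mono ?_
  rintro _ ⟨q, rfl⟩
  exact ⟨⟨q.1, q.2⟩, rfl⟩

lemma map_mem_of_mem_topologicalClosure [CompactSpace G] [T2Space G] {P : Subgroup (G ≃ₜ* G)}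
    {H : Subgroup G} (hcl : IsClosed (H : Set G)) (hH : ∀ f ∈ P, ∀ h ∈ H, f h ∈ H) :
    ∀ f ∈ P.topologicalClosure, ∀ h ∈ H, f h ∈ H := fun f hf h hh => by
  have hev : Continuous fun f : G ≃ₜ* G => f h :=
    (continuous_eval_const h : Continuous fun f : C(G, G) => f h).comp
      ContinuousMulEquiv.continuous_autToContinuousMap
  exact hcl.closure_subset <|
    map_mem_closure (f := fun f : G ≃ₜ* G => f h) hev hf fun f hf => hH f hf h hh

end Continuity

/-! ### Coarser Hausdorff group topologies on `G ⋊ P` -/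

section Coarser

variable {G : Type*} [Group G] [TopologicalSpace G] {P : Subgroup (G ≃ₜ* G)}
  {X : Type*} [Group X] [TopologicalSpace X] [IsTopologicalGroup X]

/-- The elements of `G` in the closure of `P` for a coarser group topology on `G ⋊ P`. -/
def closureTrace (φ : AutSemidirect P ≃* X) : Subgroup G :=
  ((φ.toMonoidHom.comp inr).range.topologicalClosure).comap (φ.toMonoidHom.comp inl)

lemma mem_closureTrace {φ : AutSemidirect P ≃* X} {h : G} :
    h ∈ closureTrace φ ↔ φ (inl h) ∈ closure (Set.range fun f : P => φ (inr f)) :=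
  Iff.rfl

lemma isClosed_closureTrace {φ : AutSemidirect P ≃* X} (hφ : Continuous φ) :
    IsClosed (closureTrace φ : Set G) :=
  isClosed_closure.preimage (hφ.comp (continuous_inl P))

variable [IsTopologicalGroup G]

/-- Conjugation on the compact normal subgroup `G` is continuous for every coarser Hausdorff group
topology on `G ⋊ P`. -/
lemma continuous_conjAut_symm [CompactSpace G] [T2Space X] (φ : AutSemidirect P ≃* X)
    (hφ : Continuous φ) : Continuous fun x : X => conjAut P (φ.symm x) := by
  -- By compactness `G` embeds in `X`, so continuity of the action can be tested there, where it is
  -- conjugation in `X`.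
  have hj : IsClosedEmbedding fun g : G => φ (inl g) :=
    (hφ.comp (continuous_inl P)).isClosedEmbedding
      (φ.injective.comp SemidirectProduct.inl_injective)
  refine continuous_induced_rng.2 (ContinuousMap.continuous_of_continuous_uncurry _ ?_)
  refine hj.isInducing.continuous_iff.2 ?_
  have h : Continuous fun q : X × G => q.1 * φ (inl q.2) * q.1⁻¹ :=
    (continuous_fst.mul (hj.continuous.comp continuous_snd)).mul continuous_fst.inv
  refine h.congr fun q => ?_
  change _ = φ (inl (conjAut P (φ.symm q.1) q.2))
  rw [inl_conjAut]
  simp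

lemma map_mem_closureTrace (φ : AutSemidirect P ≃* X) {f : G ≃ₜ* G} (hf : f ∈ P) {h : G}
    (hh : h ∈ closureTrace φ) : f h ∈ closureTrace φ := by
  have hmem : φ (inr ⟨f, hf⟩) ∈ (φ.toMonoidHom.comp inr).range.topologicalClosure :=
    Subgroup.le_topologicalClosure _ ⟨⟨f, hf⟩, rfl⟩
  have := mul_mem (mul_mem hmem (show φ (inl h) ∈ _ from hh)) (inv_mem hmem)
  rw [← map_inv, ← map_mul, ← map_mul, ← inl_conjAut, conjAut_inr] at this
  exact this

variable [CompactSpace G] [T2Space X]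

lemma innerAut_mem_closure {φ : AutSemidirect P ≃* X} (hφ : Continuous φ) {h : G}
    (hh : h ∈ closureTrace φ) :
    ContinuousMulEquiv.innerAut G h ∈ closure (P : Set (G ≃ₜ* G)) := by
  have := map_mem_closure (continuous_conjAut_symm φ hφ) (mem_closureTrace.1 hh)
    (t := (P : Set (G ≃ₜ* G))) (by
      rintro _ ⟨f, rfl⟩
      simp only [MulEquiv.symm_apply_apply, conjAut_inr]
      exact f.2)
  simpa only [MulEquiv.symm_apply_apply, conjAut_inl] using this

/-- If elements of `P` tend coarsely to `h`, `conjAut` makes them tend to `γ_h` in `Aut(G)`. When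
`γ_h ∈ P`, they also tend coarsely to `γ_h`, so `(h, 1) = (1, γ_h)`. -/
lemma eq_one_of_innerAut_mem {φ : AutSemidirect P ≃* X} (hφ : Continuous φ) {h : G}
    (hh : h ∈ closureTrace φ) (hP : ContinuousMulEquiv.innerAut G h ∈ P) : h = 1 := by
  obtain ⟨u, hu, hlim⟩ := mem_closure_iff_ultrafilter.1 (mem_closureTrace.1 hh)
  have hconj : Tendsto (fun x => conjAut P (φ.symm x)) u
      (𝓝 (ContinuousMulEquiv.innerAut G h)) := by
    have := ((continuous_conjAut_symm φ hφ).tendsto (φ (inl h))).mono_left hlim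
    simpa only [MulEquiv.symm_apply_apply, conjAut_inl] using this
  obtain ⟨v, hv⟩ : ∃ v : Filter P, map (fun f : P => φ (inr f)) v = u :=
    ⟨comap _ (u : Filter X), map_comap_of_mem hu⟩
  have hv0 : v.NeBot := by
    rw [← map_neBot_iff (fun f : P => φ (inr f)), hv]
    infer_instance
  rw [← hv, tendsto_map'_iff] at hconj
  have hvP : Tendsto id v (𝓝 (⟨_, hP⟩ : P)) := by
    refine tendsto_subtype_rng.2 (hconj.congr fun f => ?_)
    simp only [Function.comp_apply, MulEquiv.symm_apply_apply, conjAut_inr]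
    rfl
  have h1 : Tendsto (fun f : P => φ (inr f)) v (𝓝 (φ (inr ⟨_, hP⟩))) :=
    ((hφ.comp (continuous_inr P)).tendsto _).comp hvP
  have h2 : Tendsto (fun f : P => φ (inr f)) v (𝓝 (φ (inl h))) := by
    rw [Tendsto, hv]
    exact hlim
  have := congrArg SemidirectProduct.left (φ.injective (tendsto_nhds_unique h2 h1))
  simpa using this

/-- If `closureTrace φ` is trivial, the coarser topology agrees with the given one. -/
lemma comap_nhds_one_le {φ : AutSemidirect P ≃* X} (hφ : Continuous φ)
    (hbot : closureTrace φ = ⊥) : comap φ (𝓝 1) ≤ 𝓝 1 := by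
  refine le_iff_ultrafilter.2 fun u hu => ?_
  have hu : Tendsto φ u (𝓝 1) := tendsto_iff_comap.2 hu
  obtain ⟨g, hg⟩ : ∃ g : G, Tendsto (fun m : AutSemidirect P => m.left) u (𝓝 g) :=
    ⟨_, (u.map fun m : AutSemidirect P => m.left).le_nhds_lim⟩
  have hright : Tendsto (fun m : AutSemidirect P => φ (inr m.right)) u (𝓝 (φ (inl g⁻¹))) := by
    have h1 : Tendsto (fun m : AutSemidirect P => φ (inl m.left)) u (𝓝 (φ (inl g))) :=
      ((hφ.comp (continuous_inl P)).tendsto g).comp hg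
    have h2 := h1.inv.mul hu
    rw [mul_one, ← map_inv, ← map_inv] at h2
    refine h2.congr fun m => ?_
    rw [← map_inv, ← map_mul]
    congr 1
    rw [inv_mul_eq_iff_eq_mul, SemidirectProduct.inl_left_mul_inr_right]
  have hmem : g⁻¹ ∈ closureTrace φ :=
    mem_closureTrace.2 (mem_closure_of_tendsto hright (.of_forall fun m => ⟨m.right, rfl⟩))
  rw [hbot, Subgroup.mem_bot] at hmem
  obtain rfl : g = 1 := inv_eq_one.1 hmem
  -- The `P`-coordinates tend coarsely to 1; `conjAut` turns this into convergence in `Aut(G)`.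
  have hconj := ((continuous_conjAut_symm φ hφ).tendsto _).comp hright
  simp only [Function.comp_def, MulEquiv.symm_apply_apply, conjAut_inr, inv_one, map_one] at hconj
  have hP : Tendsto (fun m : AutSemidirect P => m.right) u (𝓝 1) :=
    tendsto_subtype_rng.2 hconj
  exact ((continuous_mk P).tendsto (1, 1)).comp (hg.prodMk_nhds hP)

end Coarser

/-! ### The coarser topology obtained from a quotient of `G ⋊ cl(P)` -/

section Quotient

variable {G : Type*} [Group G] [TopologicalSpace G] [IsTopologicalGroup G]

/-- The subgroup `{(h, γ_h⁻¹) : h ∈ H}` of `G ⋊ Q`: the part of the kernel of `conjAut Q` lying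
over `H`. -/
def antidiagonal (Q : Subgroup (G ≃ₜ* G)) (H : Subgroup G)
    (hH : ∀ f ∈ Q, ∀ h ∈ H, f h ∈ H) : Subgroup (AutSemidirect Q) where
  carrier := {m | m.left ∈ H ∧ conjAut Q m = 1}
  one_mem' := ⟨H.one_mem, map_one _⟩
  mul_mem' {a b} ha hb :=
    ⟨H.mul_mem ha.1 (hH _ a.right.2 _ hb.1), by rw [map_mul, ha.2, hb.2, one_mul]⟩
  inv_mem' {a} ha :=
    ⟨hH _ (a.right⁻¹).2 _ (H.inv_mem ha.1), by rw [map_inv, ha.2, inv_one]⟩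

/-- The kernel of `conjAut` centralizes `G`, so conjugation by `x` acts on it as conjugation by the
`Q`-part of `x`, which preserves `H`. -/
lemma normal_antidiagonal {Q : Subgroup (G ≃ₜ* G)} {H : Subgroup G}
    (hH : ∀ f ∈ Q, ∀ h ∈ H, f h ∈ H) : (antidiagonal Q H hH).Normal where
  conj_mem m hm x := by
    have hker : conjAut Q (x * m * x⁻¹) = 1 := by
      rw [map_mul, map_mul, hm.2, map_inv, mul_one, mul_inv_cancel]
    refine ⟨?_, hker⟩
    have hcomm := inl_conjAut Q (x * m * x⁻¹) x.left
    rw [hker, eq_mul_inv_iff_mul_eq] at hcomm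
    have hx : x * m * x⁻¹ = inr x.right * m * inr x.right⁻¹ :=
      calc x * m * x⁻¹ = (inl x.left)⁻¹ * (x * m * x⁻¹ * inl x.left) := by
            rw [← hcomm]
            exact (inv_mul_cancel_left _ _).symm
        _ = ((inl x.left)⁻¹ * x) * m * ((inl x.left)⁻¹ * x)⁻¹ := by group
        _ = inr x.right * m * inr x.right⁻¹ := by
            rw [map_inv, inv_mul_eq_iff_eq_mul.2
              (SemidirectProduct.inl_left_mul_inr_right x).symm]
    rw [hx]
    have : (inr x.right * m * inr x.right⁻¹).left = (x.right : G ≃ₜ* G) m.left := by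
      simp
      rfl
    rw [this]
    exact hH _ x.right.2 _ hm.1

lemma isClosed_antidiagonal [CompactSpace G] [T2Space G] {Q : Subgroup (G ≃ₜ* G)}
    {H : Subgroup G} (hcl : IsClosed (H : Set G)) (hH : ∀ f ∈ Q, ∀ h ∈ H, f h ∈ H) :
    IsClosed (antidiagonal Q H hH : Set (AutSemidirect Q)) :=
  (hcl.preimage (continuous_left Q)).inter <|
    -- The original topology counts as a coarser one, so `conjAut` is continuous for it.
    isClosed_singleton.preimage (continuous_conjAut_symm (MulEquiv.refl _) continuous_id)

/-- The topology that `G ⋊ P` inherits from the quotient of `G ⋊ cl(P)` by `antidiagonal` is a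
strictly coarser Hausdorff group topology. -/
lemma not_isMinimalTopologicalGroup [CompactSpace G] [T2Space G] {P : Subgroup (G ≃ₜ* G)} {H : Subgroup G}
    (hcl : IsClosed (H : Set G)) (hne : H ≠ ⊥) (hZ : H ⊓ Subgroup.center G = ⊥)
    (hH : ∀ f ∈ P, ∀ h ∈ H, f h ∈ H)
    (hc : ((H.map (ContinuousMulEquiv.innerAut G) : Subgroup (G ≃ₜ* G)) : Set (G ≃ₜ* G)) ⊆
      closure (P : Set (G ≃ₜ* G)))
    (hd : H.map (ContinuousMulEquiv.innerAut G) ⊓ P = ⊥) :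
    ¬ IsMinimalTopologicalGroup (AutSemidirect P) := by
  have hQ := map_mem_of_mem_topologicalClosure hcl hH
  set Q := P.topologicalClosure
  have hPQ : P ≤ Q := P.le_topologicalClosure
  let N := antidiagonal Q H hQ
  have : N.Normal := normal_antidiagonal hQ
  have : IsClosed (N : Set (AutSemidirect Q)) := isClosed_antidiagonal hcl hQ
  let ψ : AutSemidirect P →* AutSemidirect Q ⧸ N := (QuotientGroup.mk' N).comp (inclusion hPQ)
  have hcont : Continuous ψ := QuotientGroup.continuous_mk.comp (continuous_inclusion hPQ)
  have hinj : Function.Injective ψ := by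
    refine (injective_iff_map_eq_one ψ).2 fun m hm => ?_
    obtain ⟨hleft, hker⟩ : inclusion hPQ m ∈ N := (QuotientGroup.eq_one_iff _).1 hm
    have hker : ContinuousMulEquiv.innerAut G m.left * (m.right : G ≃ₜ* G) = 1 := hker
    have hmem : ContinuousMulEquiv.innerAut G m.left ∈
        H.map (ContinuousMulEquiv.innerAut G) ⊓ P :=
      ⟨Subgroup.mem_map_of_mem _ hleft, by
        rw [eq_inv_of_mul_eq_one_left hker]
        exact P.inv_mem m.right.2⟩
    rw [hd, Subgroup.mem_bot] at hmem
    have hcenter : m.left ∈ H ⊓ Subgroup.center G :=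
      ⟨hleft, Subgroup.mem_center_iff.2 fun x =>
        (mul_inv_eq_iff_eq_mul.1 (DFunLike.congr_fun hmem x :)).symm⟩
    rw [hZ, Subgroup.mem_bot] at hcenter
    rw [hmem, one_mul] at hker
    exact SemidirectProduct.ext hcenter (Subtype.ext hker)
  refine not_not.2 ⟨TopologicalSpace.induced ψ inferInstance,
    lt_of_le_of_ne (continuous_iff_le_induced.1 hcont) fun heq => ?_,
    topologicalGroup_induced ψ, ?_⟩
  · obtain ⟨h, hh, h1⟩ := (Subgroup.bot_or_exists_ne_one H).resolve_left hne
    have hmem : (ContinuousMulEquiv.innerAut G h)⁻¹ ∈ Q :=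
      Q.inv_mem (hc (Subgroup.mem_map_of_mem _ hh))
    let n : AutSemidirect Q := ⟨h, ⟨_, hmem⟩⟩
    have hn : n ∈ N := ⟨hh, mul_inv_cancel _⟩
    -- By density, a proper filter on `G ⋊ P` tends to `n ≠ 1`. Its image in the quotient tends to
    -- 1, so equal topologies would give `n` a second limit 1.
    have hNe : (comap (inclusion hPQ) (𝓝 n)).NeBot :=
      comap_neBot_iff_frequently.2
        (mem_closure_iff_frequently.1 (denseRange_inclusion hPQ subset_rfl n))
    have hψ : Tendsto ψ (comap (inclusion hPQ) (𝓝 n)) (𝓝 (ψ 1)) := by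
      have h2 := (QuotientGroup.continuous_mk (N := N)).tendsto n |>.comp
        (tendsto_comap (f := inclusion hPQ))
      rw [(QuotientGroup.eq_one_iff n).2 hn] at h2
      rw [map_one]
      exact h2
    have hle : comap (inclusion hPQ) (𝓝 n) ≤ 𝓝 1 := by
      rw [(⟨heq⟩ : IsInducing ψ).nhds_eq_comap]
      exact tendsto_iff_comap.1 hψ
    have hι : Tendsto (inclusion hPQ) (comap (inclusion hPQ) (𝓝 n)) (𝓝 (inclusion hPQ 1)) :=
      ((continuous_inclusion hPQ).tendsto 1).mono_left hle
    exact h1 (congrArg SemidirectProduct.left (tendsto_nhds_unique tendsto_comap hι))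
  · let _ : TopologicalSpace (AutSemidirect P) := TopologicalSpace.induced ψ inferInstance
    exact T2Space.of_injective_continuous hinj continuous_induced_dom

end Quotient

end AutSemidirect

theorem mainTheorem2 {G : Type*} [Group G] [TopologicalSpace G] [IsTopologicalGroup G]
    [CompactSpace G] [T2Space G] (P : Subgroup (G ≃ₜ* G)) :
    ¬ IsMinimalTopologicalGroup (AutSemidirect P) ↔
      ∃ H : Subgroup G, IsClosed (H : Set G) ∧ H ≠ ⊥ ∧
        H ⊓ Subgroup.center G = ⊥ ∧
        (∀ f ∈ P, ∀ h ∈ H, f h ∈ H) ∧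
        ((H.map (ContinuousMulEquiv.innerAut G) : Subgroup (G ≃ₜ* G)) : Set (G ≃ₜ* G)) ⊆
          closure (P : Set (G ≃ₜ* G)) ∧
        H.map (ContinuousMulEquiv.innerAut G) ⊓ P = ⊥ := by
  constructor
  · intro hmin
    obtain ⟨s, hlt, hgrp, hT2⟩ := not_not.1 hmin
    let φ := MulEquiv.refl (AutSemidirect P)
    have hφ : @Continuous (AutSemidirect P) (AutSemidirect P)
        (SemidirectProduct.instTopologicalSpaceProd _) s φ := continuous_id_iff_le.2 hlt.le
    refine ⟨@AutSemidirect.closureTrace G _ _ P _ _ s hgrp φ,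
      AutSemidirect.isClosed_closureTrace hφ, fun hbot => hlt.ne ?_, ?_,
      fun f hf h hh => AutSemidirect.map_mem_closureTrace φ hf hh, ?_, ?_⟩
    · refine IsTopologicalGroup.ext inferInstance hgrp
        (le_antisymm (nhds_mono hlt.le) ?_)
      have := AutSemidirect.comap_nhds_one_le hφ hbot
      rwa [show (φ : AutSemidirect P → AutSemidirect P) = id from rfl, comap_id] at this
    -- For central `h`, `γ_h = id` lies in `P`, so (a) follows from the same lemma as the second
    -- half of (c).
    · refine (Subgroup.eq_bot_iff_forall _).2 fun h hh =>
        AutSemidirect.eq_one_of_innerAut_mem hφ hh.1 ?_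
      have : ContinuousMulEquiv.innerAut G h = 1 := ContinuousMulEquiv.ext fun x =>
        mul_inv_eq_iff_eq_mul.2 (Subgroup.mem_center_iff.1 hh.2 x).symm
      rw [this]
      exact P.one_mem
    · rintro _ ⟨h, hh, rfl⟩
      exact AutSemidirect.innerAut_mem_closure hφ hh
    · refine (Subgroup.eq_bot_iff_forall _).2 ?_
      rintro _ ⟨⟨h, hh, rfl⟩, hP⟩
      rw [AutSemidirect.eq_one_of_innerAut_mem hφ hh hP, map_one]
  · rintro ⟨H, hcl, hne, hZ, hH, hc, hd⟩
    exact AutSemidirect.not_isMinimalTopologicalGroup hcl hne hZ hH hc hd
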